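/- Let $k$ be an arbitrary field. A \emph{Novikov algebra} over $k$ is a $k$-vector space $L$ with a $k$-bilinear multiplication such that, for all $x,y,z\in L$, $$x(yz)-(xy)z=y(xz)-(yx)z\qquad\text{and}\qquad (xy)z=(xz)y .$$ Novikov algebras, with the $k$-linear multiplicative maps as morphisms, form a category $\mathbf{Nov}_k$. A pointed category with finite products and finite coproducts is \emph{semi-abelian} if it is Barr-exact and Bourn-protomodular. A \emph{split extension} with kernel $X$ in such a category is a diagram $X\xrightarrow{\mu}E\xrightarrow{p}A$ with $\mu=\ker p$, together with a morphism $s\colon A\to E$ such that $ps=\mathrm{id}_A$. A morphism from $(E,A,p,s,\mu)$ to $(E',A',p',s',\mu')$ is a pair of morphisms $f\colon E\to E'$, $g\colon A\to A'$ with $f\mu=\mu'$, $p'f=gp$ and $fs=s'g$; this defines a category $\mathrm{Split}(X)$. An object of $\mathrm{Split}(X)$ is \emph{faithful} if every object of $\mathrm{Split}(X)$ admits at most one morphism into it, and \emph{accessible} if it admits a morphism into a faithful object. A semi-abelian category is \emph{action accessible} if, for every object $X$, every object of $\mathrm{Split}(X)$ is accessible. \textbf{Proposition.} The category $\mathbf{Nov}_k$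 is semi-abelian and action accessible. -/

import Mathlib

open CategoryTheory CategoryTheory.Limits

universe u v w

/-! ### Semi-abelian categories -/

/-- A category is Barr-exact if it is regular and every internal equivalence relation is the kernel
pair of some morphism. -/
structure IsBarrExact (C : Type u) [Category.{v} C] : Prop where
  regular : CategoryTheory.Regular C
  effective : ∀ ⦃R X : C⦄ (p₁ p₂ : R ⟶ X), IsEquivalenceRelation p₁ p₂ →
    ∃ (Y : C) (f : X ⟶ Y), IsKernelPair f p₁ p₂

/-- Bourn-protomodularity (for a category with pullbacks): the change-of-base functors of the
fibration of points reflect isomorphisms.  Here `(p, s)` and `(p', s')` are points over `B`, `h` is a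
morphism of points over `B`, the points `(q, t)` and `(q', t')` over `A` are their pullbacks along
`b : A ⟶ B`, and `h'` is the morphism of points over `A` induced by `h`. -/
def IsProtomodular (C : Type u) [Category.{v} C] : Prop :=
  ∀ ⦃A B E E' D D' : C⦄ (b : A ⟶ B)
    (p : E ⟶ B) (s : B ⟶ E) (p' : E' ⟶ B) (s' : B ⟶ E')
    (h : E ⟶ E')
    (c : D ⟶ E) (q : D ⟶ A) (t : A ⟶ D) (c' : D' ⟶ E') (q' : D' ⟶ A) (t' : A ⟶ D')
    (h' : D ⟶ D'),
    s ≫ p = 𝟙 B → s' ≫ p' = 𝟙 B → h ≫ p' = p → s ≫ h = s' →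
    IsPullback c q p b → t ≫ q = 𝟙 A → t ≫ c = b ≫ s →
    IsPullback c' q' p' b → t' ≫ q' = 𝟙 A → t' ≫ c' = b ≫ s' →
    h' ≫ c' = c ≫ h → h' ≫ q' = q →
    IsIso h' → IsIso h

/-- A semi-abelian category: a pointed category with finite products and finite coproducts that is
Barr-exact and Bourn-protomodular. -/
structure IsSemiAbelian (C : Type u) [Category.{v} C] : Prop where
  hasZeroObject : HasZeroObject C
  hasFiniteProducts : HasFiniteProducts C
  hasFiniteCoproducts : HasFiniteCoproducts C
  barrExact : IsBarrExact C
  protomodular : IsProtomodular C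

/-! ### Split extensions with fixed kernel -/

/-- A split extension with kernel `X`: a diagram `X ⟶ E ⇄ A` in which `ι : X ⟶ E` is a kernel of
`p : E ⟶ A` and `s : A ⟶ E` is a section of `p`. -/
structure SplitExtension {C : Type u} [Category.{v} C] [HasZeroMorphisms C] (X : C) where
  E : C
  A : C
  ι : X ⟶ E
  p : E ⟶ A
  s : A ⟶ E
  ι_p : ι ≫ p = 0
  isKernel : Nonempty (IsLimit (KernelFork.ofι ι ι_p))
  s_p : s ≫ p = 𝟙 A

namespace SplitExtension

variable {C : Type u} [Category.{v} C] [HasZeroMorphisms C] {X : C}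

/-- A morphism of split extensions with kernel `X`: it is the identity on `X`. -/
@[ext]
structure Hom (S T : SplitExtension X) where
  onE : S.E ⟶ T.E
  onA : S.A ⟶ T.A
  ι_onE : S.ι ≫ onE = T.ι
  onE_p : onE ≫ T.p = S.p ≫ onA
  s_onE : S.s ≫ onE = onA ≫ T.s

/-- The category of split extensions with kernel `X`. -/
instance : Category (SplitExtension X) where
  Hom S T := Hom S T
  id S := ⟨𝟙 S.E, 𝟙 S.A, by simp, by simp, by simp⟩
  comp f g := ⟨f.onE ≫ g.onE, f.onA ≫ g.onA, by rw [← Category.assoc, f.ι_onE, g.ι_onE],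
    by rw [Category.assoc, g.onE_p, ← Category.assoc, f.onE_p, Category.assoc],
    by rw [← Category.assoc, f.s_onE, Category.assoc, g.s_onE, Category.assoc]⟩
  id_comp f := Hom.ext (Category.id_comp f.onE) (Category.id_comp f.onA)
  comp_id f := Hom.ext (Category.comp_id f.onE) (Category.comp_id f.onA)
  assoc f g h := Hom.ext (Category.assoc f.onE g.onE h.onE) (Category.assoc f.onA g.onA h.onA)

/-- A split extension is faithful if every object of the category of split extensions with the same
kernel admits at most one morphism into it. -/
def IsFaithful (T : SplitExtension X) : Prop :=
  ∀ (S : SplitExtension X) (f g : S ⟶ T), f = g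

/-- A split extension is accessible if it admits a morphism into a faithful one. -/
def IsAccessible (S : SplitExtension X) : Prop :=
  ∃ T : SplitExtension X, T.IsFaithful ∧ Nonempty (S ⟶ T)

end SplitExtension

/-- An action accessible category: a semi-abelian category in which every split extension is
accessible. -/
structure IsActionAccessible (C : Type u) [Category.{v} C] [HasZeroMorphisms C] : Prop where
  semiAbelian : IsSemiAbelian C
  accessible : ∀ (X : C) (S : SplitExtension X), S.IsAccessible

/-! ### Novikov algebras -/

/-- A Novikov algebra has as underlying ring a left pre-Lie ring (the associator is symmetric in its
first two arguments) in which the right multiplications commute. -/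
class NovikovRing (L : Type w) extends LeftPreLieRing L where
  mul_mul_right_comm (x y z : L) : x * y * z = x * z * y

/-- The variety of Novikov algebras over `k`.  The class `LeftPreLieAlgebra k L` says that `L` is a
`k`-module on which the multiplication is `k`-bilinear. -/
structure NovikovAlgCat (k : Type u) [Field k] where
  carrier : Type v
  [novikovRing : NovikovRing carrier]
  [algebra : LeftPreLieAlgebra k carrier]

namespace NovikovAlgCat

variable {k : Type u} [Field k]

attribute [instance] novikovRing algebra

instance : CoeSort (NovikovAlgCat.{u, v} k) (Type v) := ⟨carrier⟩

/-- A morphism of Novikov algebras is a `k`-linear multiplicative map. -/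
@[ext]
structure Hom (L M : NovikovAlgCat.{u, v} k) where
  hom : L →ₙₐ[k] M

instance : Category (NovikovAlgCat.{u, v} k) where
  Hom L M := Hom L M
  id L := ⟨NonUnitalAlgHom.id k L⟩
  comp f g := ⟨g.hom.comp f.hom⟩

/-- The zero morphisms are the zero maps. -/
instance : HasZeroMorphisms (NovikovAlgCat.{u, v} k) where
  zero _ _ := ⟨⟨0⟩⟩
  comp_zero _ _ := rfl
  zero_comp _ _ _ f := Hom.ext (NonUnitalAlgHom.ext fun _ => map_zero f.hom)

end NovikovAlgCat

/-! Semi-abelianness is the usual fact about varieties whose algebras have an underlying group and a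
single constant, and is checked on elements. Regular epimorphisms are the surjections, and these are
stable under pullback. A reflexive relation compatible with addition is congruence modulo the ideal
of elements related to zero, so it is a kernel pair (`isKernelPair_quotMk_relIdeal`).
Protomodularity is the split short five lemma, which needs only subtraction. Coproducts are
quotients of free nonassociative algebras.

Action accessibility is where the Novikov identities matter. For a split extension of `A` by `X`,
let `Z` be the set of those `a` in `A` with `a x = 0 = x a` for all `x` in `X`. Writing `x(yz) =
(xy)z + y(xz) - (yx)z` and `(xy)z = (xz)y` shows that `Z` is an ideal of `A` (`centralizer`). Since
`Z` annihilates `X`, its image under the section is an ideal of `E` meeting `X` only in zero.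
Dividing out gives a split extension with the same kernel `X` and base `A/Z`, in which only zero
acts trivially. Such an extension is faithful (`isFaithful_of_actsTrivially`), because morphisms
into it are determined by the action on `X`. -/

/-! ### Quotients of nonassociative algebras by two-sided ideals -/

/-- A two-sided ideal of a nonassociative algebra `A` over `k`. -/
structure AlgIdeal (k : Type*) (A : Type*) [Field k] [NonUnitalNonAssocRing A] [Module k A]
    extends Submodule k A where
  mul_left_mem (a : A) {x : A} (hx : x ∈ carrier) : a * x ∈ carrier
  mul_right_mem (a : A) {x : A} (hx : x ∈ carrier) : x * a ∈ carrier

namespace AlgIdeal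

variable {k : Type*} [Field k] {A : Type*} [NonUnitalNonAssocRing A] [Module k A]
  (I : AlgIdeal k A)

/-- The quotient algebra. -/
abbrev Quotient : Type _ := A ⧸ I.toSubmodule

/-- The class of an element in the quotient algebra. -/
abbrev toQuotient (a : A) : I.Quotient := Submodule.Quotient.mk a

theorem toQuotient_eq_zero {a : A} : I.toQuotient a = 0 ↔ a ∈ I.toSubmodule :=
  Submodule.Quotient.mk_eq_zero _

theorem toQuotient_eq {a b : A} : I.toQuotient a = I.toQuotient b ↔ a - b ∈ I.toSubmodule :=
  Submodule.Quotient.eq _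

theorem toQuotient_surjective : Function.Surjective I.toQuotient :=
  Submodule.Quotient.mk_surjective _

instance : Mul I.Quotient where
  mul x y := _root_.Quotient.liftOn₂' x y (fun a b => I.toQuotient (a * b)) (by
    intro a b a' b' ha hb
    rw [Submodule.quotientRel_def] at ha hb
    refine (I.toQuotient_eq).2 ?_
    have h : a * b - a' * b' = (a - a') * b + a' * (b - b') := by
      rw [sub_mul, mul_sub]; abel
    rw [h]
    exact I.toSubmodule.add_mem (I.mul_right_mem _ ha) (I.mul_left_mem _ hb))

instance : NonUnitalNonAssocRing I.Quotient where
  left_distrib x y z := by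
    obtain ⟨x, rfl⟩ := I.toQuotient_surjective x
    obtain ⟨y, rfl⟩ := I.toQuotient_surjective y
    obtain ⟨z, rfl⟩ := I.toQuotient_surjective z
    exact congrArg I.toQuotient (mul_add x y z)
  right_distrib x y z := by
    obtain ⟨x, rfl⟩ := I.toQuotient_surjective x
    obtain ⟨y, rfl⟩ := I.toQuotient_surjective y
    obtain ⟨z, rfl⟩ := I.toQuotient_surjective z
    exact congrArg I.toQuotient (add_mul x y z)
  zero_mul x := by
    obtain ⟨x, rfl⟩ := I.toQuotient_surjective x
    exact congrArg I.toQuotient (zero_mul x)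
  mul_zero x := by
    obtain ⟨x, rfl⟩ := I.toQuotient_surjective x
    exact congrArg I.toQuotient (mul_zero x)

instance [IsScalarTower k A A] : IsScalarTower k I.Quotient I.Quotient where
  smul_assoc c x y := by
    obtain ⟨x, rfl⟩ := I.toQuotient_surjective x
    obtain ⟨y, rfl⟩ := I.toQuotient_surjective y
    exact congrArg I.toQuotient (smul_assoc c x y)

instance [SMulCommClass k A A] : SMulCommClass k I.Quotient I.Quotient where
  smul_comm c x y := by
    obtain ⟨x, rfl⟩ := I.toQuotient_surjective x
    obtain ⟨y, rfl⟩ := I.toQuotient_surjective y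
    exact congrArg I.toQuotient (smul_comm c x y)

/-- The quotient map as a homomorphism of algebras. -/
def mkHom : A →ₙₐ[k] I.Quotient where
  toFun := I.toQuotient
  map_smul' _ _ := rfl
  map_zero' := rfl
  map_add' _ _ := rfl
  map_mul' _ _ := rfl

theorem mkHom_surjective : Function.Surjective I.mkHom := I.toQuotient_surjective

theorem mkHom_eq_zero {a : A} : I.mkHom a = 0 ↔ a ∈ I.toSubmodule := I.toQuotient_eq_zero

/-- The kernel of a homomorphism of algebras. -/
def ker {B : Type*} [NonUnitalNonAssocRing B] [Module k B] (f : A →ₙₐ[k] B) : AlgIdeal k A where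
  carrier := {x | f x = 0}
  zero_mem' := map_zero f
  add_mem' {a b} (ha : f a = 0) (hb : f b = 0) := show f (a + b) = 0 by
    rw [map_add, ha, hb, add_zero]
  smul_mem' c x (hx : f x = 0) := show f (c • x) = 0 by rw [map_smul, hx, smul_zero]
  mul_left_mem a x (hx : f x = 0) := show f (a * x) = 0 by rw [map_mul, hx, mul_zero]
  mul_right_mem a x (hx : f x = 0) := show f (x * a) = 0 by rw [map_mul, hx, zero_mul]

theorem mem_ker {B : Type*} [NonUnitalNonAssocRing B] [Module k B] {f : A →ₙₐ[k] B} {a : A} :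
    a ∈ (ker f).toSubmodule ↔ f a = 0 := Iff.rfl

end AlgIdeal

/-! ### Constructing homomorphisms of nonassociative algebras -/

namespace NonUnitalAlgHom

variable {k : Type*} [Field k] {A B C : Type*} [NonUnitalNonAssocRing A] [Module k A]
  [NonUnitalNonAssocRing B] [Module k B] [NonUnitalNonAssocRing C] [Module k C]

/-- The map `g` is constant on the fibres of `f`, so composing it with any set-theoretic section of
`f` gives a homomorphism, even if the section is not linear. -/
theorem exists_comp_eq_of_surjective {f : A →ₙₐ[k] B} (hf : Function.Surjective f)
    {g : A →ₙₐ[k] C} (hg : ∀ a, f a = 0 → g a = 0) : ∃ u : B →ₙₐ[k] C, ∀ a, u (f a) = g a := by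
  have key : ∀ a b, f a = f b → g a = g b := fun a b h => by
    have := hg (a - b) (by rw [map_sub, h, sub_self])
    rwa [map_sub, sub_eq_zero] at this
  choose σ hσ using hf
  have hu : ∀ a, g (σ (f a)) = g a := fun a => key _ _ (hσ _)
  refine ⟨
    { toFun := fun b => g (σ b)
      map_smul' := ?_
      map_zero' := ?_
      map_add' := ?_
      map_mul' := ?_ }, hu⟩
  · intro c x
    rw [MonoidHom.id_apply, ← map_smul]
    exact key _ _ (by rw [hσ, map_smul, hσ])
  · rw [← map_zero g]
    exact key _ _ (by rw [hσ, map_zero])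
  · intro x y
    rw [← map_add]
    exact key _ _ (by rw [hσ, map_add, hσ, hσ])
  · intro x y
    rw [← map_mul]
    exact key _ _ (by rw [hσ, map_mul, hσ, hσ])

theorem exists_comp_eq_of_injective {m : B →ₙₐ[k] C} (hm : Function.Injective m)
    {f : A →ₙₐ[k] C} (hf : ∀ a, ∃ b, m b = f a) : ∃ l : A →ₙₐ[k] B, ∀ a, m (l a) = f a := by
  choose l hl using hf
  refine ⟨
    { toFun := l
      map_smul' := ?_
      map_zero' := ?_
      map_add' := ?_
      map_mul' := ?_ }, hl⟩
  · intro c x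
    apply hm; rw [hl, MonoidHom.id_apply, map_smul, map_smul, hl]
  · apply hm; rw [hl, map_zero, map_zero]
  · intro x y
    apply hm; rw [hl, map_add, map_add, hl, hl]
  · intro x y
    apply hm; rw [hl, map_mul, map_mul, hl, hl]

end NonUnitalAlgHom

/-! ### Constructions of Novikov algebras -/

/-- The left-symmetry identity solved for `x(yz)`, the form needed to show that the centralizer is
an ideal. -/
theorem NovikovRing.mul_left_comm' {L : Type*} [NovikovRing L] (x y z : L) :
    x * (y * z) = x * y * z + y * (x * z) - y * x * z := by
  have h := LeftPreLieRing.assoc_symm x y z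
  simp only [associator_apply] at h
  rw [sub_eq_sub_iff_add_eq_add] at h
  rw [h]; abel

/-- A nonassociative ring satisfying the two Novikov identities is a Novikov ring. -/
abbrev NovikovRing.ofIdentities {L : Type*} [R : NonUnitalNonAssocRing L]
    (h₁ : ∀ x y z : L, associator x y z = associator y x z)
    (h₂ : ∀ x y z : L, x * y * z = x * z * y) : NovikovRing L where
  __ := R
  assoc_symm' := h₁
  mul_mul_right_comm := h₂

namespace NovikovAlgCat

variable {k : Type u} [Field k]

/-- The Novikov algebra given by a nonassociative algebra satisfying the two Novikov
identities. -/
abbrev of (L : Type v) [NonUnitalNonAssocRing L] [Module k L] [IsScalarTower k L L]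
    [SMulCommClass k L L] (h₁ : ∀ x y z : L, associator x y z = associator y x z)
    (h₂ : ∀ x y z : L, x * y * z = x * z * y) : NovikovAlgCat.{u, v} k :=
  letI := NovikovRing.ofIdentities h₁ h₂
  { carrier := L
    algebra := { } }

@[simp]
theorem comp_hom_apply {L M N : NovikovAlgCat.{u, v} k} (f : L ⟶ M) (g : M ⟶ N) (x : L) :
    (f ≫ g).hom x = g.hom (f.hom x) := rfl

@[simp]
theorem id_hom_apply {L : NovikovAlgCat.{u, v} k} (x : L) : (𝟙 L : L ⟶ L).hom x = x := rfl

@[ext]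
theorem hom_ext {L M : NovikovAlgCat.{u, v} k} {f g : L ⟶ M} (h : ∀ x, f.hom x = g.hom x) :
    f = g :=
  Hom.ext (NonUnitalAlgHom.ext h)

theorem congr_hom {L M : NovikovAlgCat.{u, v} k} {f g : L ⟶ M} (h : f = g) (x : L) :
    f.hom x = g.hom x := by rw [h]

/-- The zero Novikov algebra. -/
def zero : NovikovAlgCat.{u, v} k := of PUnit.{v + 1} (fun _ _ _ => rfl) (fun _ _ _ => rfl)

/-- The product of two Novikov algebras. -/
def prod (L M : NovikovAlgCat.{u, v} k) : NovikovAlgCat.{u, v} k :=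
  of (L × M)
    (fun x y z => Prod.ext (LeftPreLieRing.assoc_symm x.1 y.1 z.1)
      (LeftPreLieRing.assoc_symm x.2 y.2 z.2))
    (fun x y z => Prod.ext (NovikovRing.mul_mul_right_comm x.1 y.1 z.1)
      (NovikovRing.mul_mul_right_comm x.2 y.2 z.2))

/-- A subalgebra of a Novikov algebra. -/
def sub {L : NovikovAlgCat.{u, v} k} (S : NonUnitalSubalgebra k L) : NovikovAlgCat.{u, v} k :=
  of S (fun x y z => Subtype.ext (LeftPreLieRing.assoc_symm x.1 y.1 z.1))
    (fun x y z => Subtype.ext (NovikovRing.mul_mul_right_comm x.1 y.1 z.1))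

/-- The quotient of a Novikov algebra by an ideal. -/
def quot {L : NovikovAlgCat.{u, v} k} (I : AlgIdeal k L) : NovikovAlgCat.{u, v} k :=
  of I.Quotient
    (by
      intro x y z
      obtain ⟨x, rfl⟩ := I.toQuotient_surjective x
      obtain ⟨y, rfl⟩ := I.toQuotient_surjective y
      obtain ⟨z, rfl⟩ := I.toQuotient_surjective z
      exact congrArg I.toQuotient (LeftPreLieRing.assoc_symm x y z))
    (by
      intro x y z
      obtain ⟨x, rfl⟩ := I.toQuotient_surjective x
      obtain ⟨y, rfl⟩ := I.toQuotient_surjective y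
      obtain ⟨z, rfl⟩ := I.toQuotient_surjective z
      exact congrArg I.toQuotient (NovikovRing.mul_mul_right_comm x y z))

/-- The quotient map. -/
def quotMk {L : NovikovAlgCat.{u, v} k} (I : AlgIdeal k L) : L ⟶ quot I := ⟨I.mkHom⟩

theorem quotMk_surjective {L : NovikovAlgCat.{u, v} k} (I : AlgIdeal k L) :
    Function.Surjective (quotMk I).hom := I.mkHom_surjective

theorem quotMk_eq_zero {L : NovikovAlgCat.{u, v} k} (I : AlgIdeal k L) {x : L} :
    (quotMk I).hom x = 0 ↔ x ∈ I.toSubmodule := I.mkHom_eq_zero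

/-- The inclusion of a subalgebra. -/
def subι {L : NovikovAlgCat.{u, v} k} (S : NonUnitalSubalgebra k L) : sub S ⟶ L :=
  ⟨NonUnitalSubalgebraClass.subtype S⟩

theorem subι_injective {L : NovikovAlgCat.{u, v} k} (S : NonUnitalSubalgebra k L) :
    Function.Injective (subι S).hom := Subtype.val_injective

theorem exists_subι_eq {L : NovikovAlgCat.{u, v} k} {S : NonUnitalSubalgebra k L} {x : L}
    (hx : x ∈ S) : ∃ y, (subι S).hom y = x := ⟨⟨x, hx⟩, rfl⟩

theorem subι_mem {L : NovikovAlgCat.{u, v} k} (S : NonUnitalSubalgebra k L) (y : sub S) :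
    (subι S).hom y ∈ S := y.2

/-! ### Lifting, descent and invertibility of morphisms, tested on elements. -/

variable {L M N K : NovikovAlgCat.{u, v} k}

theorem exists_lift_of_injective {m : M ⟶ N} (hm : Function.Injective m.hom) {f : L ⟶ N}
    (hf : ∀ x, ∃ y, m.hom y = f.hom x) : ∃ l : L ⟶ M, l ≫ m = f := by
  obtain ⟨l, hl⟩ := NonUnitalAlgHom.exists_comp_eq_of_injective hm hf
  exact ⟨⟨l⟩, hom_ext hl⟩

theorem exists_desc_of_surjective {f : L ⟶ M} (hf : Function.Surjective f.hom) {g : L ⟶ N}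
    (hg : ∀ x, f.hom x = 0 → g.hom x = 0) : ∃ d : M ⟶ N, f ≫ d = g := by
  obtain ⟨l, hl⟩ := NonUnitalAlgHom.exists_comp_eq_of_surjective hf hg
  exact ⟨⟨l⟩, hom_ext hl⟩

theorem isIso_of_bijective {f : L ⟶ M} (hf : Function.Bijective f.hom) : IsIso f := by
  obtain ⟨g, hg⟩ := exists_lift_of_injective hf.1 (f := 𝟙 M) hf.2
  refine ⟨g, hom_ext fun x => hf.1 ?_, hg⟩
  simpa using congr_hom hg (f.hom x)

theorem bijective_of_isIso (f : L ⟶ M) [IsIso f] : Function.Bijective f.hom :=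
  Function.bijective_iff_has_inverse.2 ⟨(inv f).hom,
    fun x => congr_hom (IsIso.hom_inv_id f) x, fun x => congr_hom (IsIso.inv_hom_id f) x⟩

theorem epi_of_surjective {f : L ⟶ M} (hf : Function.Surjective f.hom) : Epi f where
  left_cancellation g h w := hom_ext fun y => by
    obtain ⟨x, rfl⟩ := hf y
    exact congr_hom w x

theorem mono_of_injective {f : L ⟶ M} (hf : Function.Injective f.hom) : Mono f where
  right_cancellation _ _ w := hom_ext fun x => hf (congr_hom w x)

/-! ### Pullbacks -/

/-- The explicit pullback of two homomorphisms. -/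
def pb (f : L ⟶ N) (g : M ⟶ N) : NovikovAlgCat.{u, v} k :=
  sub (L := prod L M)
    { carrier := {x : L × M | f.hom x.1 = g.hom x.2}
      zero_mem' := (map_zero f.hom).trans (map_zero g.hom).symm
      add_mem' := fun {a b} (ha : f.hom a.1 = g.hom a.2) (hb : f.hom b.1 = g.hom b.2) => by
        change f.hom (a.1 + b.1) = g.hom (a.2 + b.2)
        rw [map_add, map_add, ha, hb]
      mul_mem' := fun {a b} (ha : f.hom a.1 = g.hom a.2) (hb : f.hom b.1 = g.hom b.2) => by
        change f.hom (a.1 * b.1) = g.hom (a.2 * b.2)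
        rw [map_mul, map_mul, ha, hb]
      smul_mem' := fun c a (ha : f.hom a.1 = g.hom a.2) => by
        change f.hom (c • a.1) = g.hom (c • a.2)
        rw [map_smul, map_smul, ha] }

/-- The first projection of the explicit pullback. -/
def pbFst (f : L ⟶ N) (g : M ⟶ N) : pb f g ⟶ L :=
  subι _ ≫ (⟨NonUnitalAlgHom.fst k L M⟩ : prod L M ⟶ L)

/-- The second projection of the explicit pullback. -/
def pbSnd (f : L ⟶ N) (g : M ⟶ N) : pb f g ⟶ M :=
  subι _ ≫ (⟨NonUnitalAlgHom.snd k L M⟩ : prod L M ⟶ M)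

theorem pb_condition (f : L ⟶ N) (g : M ⟶ N) : pbFst f g ≫ f = pbSnd f g ≫ g :=
  hom_ext fun x => x.2

theorem exists_pb (f : L ⟶ N) (g : M ⟶ N) {x : L} {y : M} (h : f.hom x = g.hom y) :
    ∃ z, (pbFst f g).hom z = x ∧ (pbSnd f g).hom z = y :=
  ⟨⟨(x, y), h⟩, rfl, rfl⟩

theorem pb_ext (f : L ⟶ N) (g : M ⟶ N) {z z' : pb f g}
    (h₁ : (pbFst f g).hom z = (pbFst f g).hom z') (h₂ : (pbSnd f g).hom z = (pbSnd f g).hom z') :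
    z = z' :=
  Subtype.ext (Prod.ext h₁ h₂)

end NovikovAlgCat

namespace NovikovAlgCat

variable {k : Type u} [Field k] {L M N K : NovikovAlgCat.{u, v} k}

/-- A commutative square is a pullback as soon as it is one on elements. -/
theorem isPullback_of_elements {p : K ⟶ L} {q : K ⟶ M} {f : L ⟶ N} {g : M ⟶ N}
    (w : p ≫ f = q ≫ g)
    (hinj : ∀ z z' : K, p.hom z = p.hom z' → q.hom z = q.hom z' → z = z')
    (hex : ∀ x y, f.hom x = g.hom y → ∃ z, p.hom z = x ∧ q.hom z = y) : IsPullback p q f g := by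
  have key : ∀ s : PullbackCone f g, ∃ l : s.pt ⟶ K, l ≫ p = s.fst ∧ l ≫ q = s.snd := by
    intro s
    obtain ⟨l, hl⟩ := exists_lift_of_injective (m := (⟨p.hom.prod q.hom⟩ : K ⟶ prod L M))
      (f := ⟨s.fst.hom.prod s.snd.hom⟩)
      (fun z z' h => hinj z z' (congrArg Prod.fst h) (congrArg Prod.snd h))
      (fun x => by
        obtain ⟨z, h₁, h₂⟩ := hex (s.fst.hom x) (s.snd.hom x) (congr_hom s.condition x)
        exact ⟨z, Prod.ext h₁ h₂⟩)
    exact ⟨l, hom_ext fun x => congrArg Prod.fst (congr_hom hl x),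
      hom_ext fun x => congrArg Prod.snd (congr_hom hl x)⟩
  choose l hl₁ hl₂ using key
  refine ⟨⟨w⟩, ⟨PullbackCone.IsLimit.mk w l hl₁ hl₂ fun s m h₁ h₂ => hom_ext fun x => ?_⟩⟩
  exact hinj _ _ (congr_hom (h₁.trans (hl₁ s).symm) x) (congr_hom (h₂.trans (hl₂ s).symm) x)

theorem isPullback_pb (f : L ⟶ N) (g : M ⟶ N) : IsPullback (pbFst f g) (pbSnd f g) f g :=
  isPullback_of_elements (pb_condition f g) (fun _ _ => pb_ext f g) (fun _ _ => exists_pb f g)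

theorem exists_of_isPullback {p : K ⟶ L} {q : K ⟶ M} {f : L ⟶ N} {g : M ⟶ N}
    (h : IsPullback p q f g) {x : L} {y : M} (e : f.hom x = g.hom y) :
    ∃ z, p.hom z = x ∧ q.hom z = y := by
  obtain ⟨z, rfl, rfl⟩ := exists_pb f g e
  exact ⟨(h.lift _ _ (pb_condition f g)).hom z, congr_hom (h.lift_fst _ _ (pb_condition f g)) z,
    congr_hom (h.lift_snd _ _ (pb_condition f g)) z⟩

/-- A jointly monic pair of homomorphisms is jointly injective. -/
theorem eq_of_jointlyMono {p : K ⟶ L} {q : K ⟶ M}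
    (h : ∀ {P : NovikovAlgCat.{u, v} k} (f g : P ⟶ K), f ≫ p = g ≫ p → f ≫ q = g ≫ q → f = g)
    {z z' : K} (h₁ : p.hom z = p.hom z') (h₂ : q.hom z = q.hom z') : z = z' := by
  let m : K ⟶ prod L M := ⟨p.hom.prod q.hom⟩
  -- The two projections of the kernel pair of the pairing `m` agree after `p` and after `q`, so
  -- joint monicity identifies them; `z` and `z'` are the components of one element of this kernel
  -- pair.
  have e : pbFst m m = pbSnd m m := h _ _
    (hom_ext fun x => congrArg Prod.fst (congr_hom (pb_condition m m) x))
    (hom_ext fun x => congrArg Prod.snd (congr_hom (pb_condition m m) x))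
  obtain ⟨x, rfl, rfl⟩ := exists_pb m m (x := z) (y := z') (Prod.ext h₁ h₂)
  exact congr_hom e x

theorem eq_of_isPullback {p : K ⟶ L} {q : K ⟶ M} {f : L ⟶ N} {g : M ⟶ N}
    (h : IsPullback p q f g) {z z' : K} (h₁ : p.hom z = p.hom z') (h₂ : q.hom z = q.hom z') :
    z = z' :=
  eq_of_jointlyMono (fun _ _ e₁ e₂ => h.hom_ext e₁ e₂) h₁ h₂

theorem injective_of_mono (f : L ⟶ M) [Mono f] : Function.Injective f.hom := fun _ _ h =>
  eq_of_jointlyMono (fun _ _ e _ => (cancel_mono f).1 e) h h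

/-! ### Limits -/

theorem isZero_zero : IsZero (zero : NovikovAlgCat.{u, v} k) where
  unique_to _ := ⟨⟨⟨0⟩, fun f => hom_ext fun _ => map_zero f.hom⟩⟩
  unique_from _ := ⟨⟨⟨0⟩, fun _ => hom_ext fun _ => rfl⟩⟩

instance : HasZeroObject (NovikovAlgCat.{u, v} k) := ⟨⟨zero, isZero_zero⟩⟩

instance : HasPullbacks (NovikovAlgCat.{u, v} k) :=
  have (L M N : NovikovAlgCat.{u, v} k) (f : L ⟶ N) (g : M ⟶ N) : HasLimit (cospan f g) :=
    (isPullback_pb f g).hasPullback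
  hasPullbacks_of_hasLimit_cospan _

instance : HasFiniteLimits (NovikovAlgCat.{u, v} k) :=
  have : HasTerminal (NovikovAlgCat.{u, v} k) := HasZeroObject.hasTerminal
  hasFiniteLimits_of_hasTerminal_and_pullbacks

/-- A monomorphism `i` is a kernel of `p` as soon as it is one on elements. -/
theorem nonempty_isLimit_kernelFork {i : K ⟶ L} {p : L ⟶ M} (w : i ≫ p = 0)
    (hinj : Function.Injective i.hom) (hex : ∀ x, p.hom x = 0 → ∃ z, i.hom z = x) :
    Nonempty (IsLimit (KernelFork.ofι i w)) := by
  have := mono_of_injective hinj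
  refine ⟨KernelFork.IsLimit.ofι' i w fun {A} j hj => Classical.indefiniteDescription _ ?_⟩
  exact exists_lift_of_injective hinj fun x => hex _ (congr_hom hj x)

theorem exists_of_isLimit_kernelFork {i : K ⟶ L} {p : L ⟶ M} {w : i ≫ p = 0}
    (h : IsLimit (KernelFork.ofι i w)) {x : L} (hx : p.hom x = 0) : ∃ z, i.hom z = x := by
  -- The pullback of `p` along a zero map serves as a test object containing every element killed by
  -- `p`.
  let j : pb p (0 : L ⟶ M) ⟶ L := pbFst p 0
  have hj : j ≫ p = 0 := by rw [pb_condition, comp_zero]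
  obtain ⟨z, rfl, -⟩ := exists_pb p (0 : L ⟶ M) (x := x) (y := 0) hx
  obtain ⟨l, hl⟩ := KernelFork.IsLimit.lift' h j hj
  exact ⟨l.hom z, congr_hom hl z⟩

theorem injective_of_isLimit_kernelFork {i : K ⟶ L} {p : L ⟶ M} {w : i ≫ p = 0}
    (h : IsLimit (KernelFork.ofι i w)) : Function.Injective i.hom := by
  have : Mono i := mono_of_isLimit_fork h
  exact injective_of_mono i

/-! ### Regularity and exactness -/

theorem surjective_of_isRegularEpi (f : L ⟶ M) [IsRegularEpi f] :
    Function.Surjective f.hom := by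
  let S : NonUnitalSubalgebra k M := NonUnitalAlgHom.range f.hom
  obtain ⟨f', hf'⟩ := exists_lift_of_injective (subι_injective S) (f := f)
    fun x => exists_subι_eq ⟨x, rfl⟩
  have := mono_of_injective (subι_injective S)
  -- The corestriction of `f` to its image descends along `f`, giving a section of the inclusion of
  -- the image; hence the image is everything.
  let d : M ⟶ sub S := IsRegularEpi.desc f f' (by
    rw [← cancel_mono (subι S), Category.assoc, Category.assoc, hf', IsRegularEpi.w])
  have hd : d ≫ subι S = 𝟙 M := by
    rw [← cancel_epi f, ← Category.assoc, IsRegularEpi.fac, hf', Category.comp_id]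
  intro y
  have := subι_mem S (d.hom y)
  rwa [← comp_hom_apply, hd] at this

theorem isRegularEpi_of_surjective {f : L ⟶ M} (hf : Function.Surjective f.hom) :
    IsRegularEpi f := by
  have := epi_of_surjective hf
  refine IsRegularEpi.of_epi_of_exists fun Z g hg => exists_desc_of_surjective hf fun x hx => ?_
  -- For `x` in the kernel of `f`, the pair `(x, 0)` lies in the kernel pair, so `g` takes the same
  -- value at `x` and at `0`.
  obtain ⟨z, h₁, h₂⟩ := exists_of_isPullback (IsPullback.of_hasPullback f f) (x := x) (y := 0)
    (by rw [hx, map_zero])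
  have := congr_hom hg z
  rwa [comp_hom_apply, comp_hom_apply, h₁, h₂, map_zero] at this

theorem hasCoequalizer_of_isKernelPair {f : L ⟶ M} {g₁ g₂ : K ⟶ L} (h : IsKernelPair f g₁ g₂) :
    HasCoequalizer g₁ g₂ := by
  let I := AlgIdeal.ker f.hom
  have w : g₁ ≫ quotMk I = g₂ ≫ quotMk I := hom_ext fun x => by
    rw [comp_hom_apply, comp_hom_apply, ← sub_eq_zero, ← map_sub, quotMk_eq_zero,
      AlgIdeal.mem_ker, map_sub, sub_eq_zero]
    exact congr_hom h.w x
  have := epi_of_surjective (quotMk_surjective I)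
  refine ⟨⟨⟨Cofork.ofπ (quotMk I) w, Cofork.IsColimit.mk' _ fun s => ?_⟩⟩⟩
  have hs : ∃ d : quot I ⟶ s.pt, quotMk I ≫ d = s.π := by
    refine exists_desc_of_surjective (quotMk_surjective I) fun x hx => ?_
    rw [quotMk_eq_zero, AlgIdeal.mem_ker] at hx
    obtain ⟨z, rfl, h₂⟩ := exists_of_isPullback h (x := x) (y := 0) (by rw [hx, map_zero])
    have := congr_hom s.condition z
    rwa [comp_hom_apply, comp_hom_apply, h₂, map_zero] at this
  choose d hd using hs
  exact ⟨d, hd, fun {m} hm => (cancel_epi (quotMk I)).1 (hm.trans hd.symm)⟩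

theorem regular : CategoryTheory.Regular (NovikovAlgCat.{u, v} k) where
  hasCoequalizer_of_isKernelPair := hasCoequalizer_of_isKernelPair
  regularEpiIsStableUnderBaseChange :=
    { of_isPullback := fun {_ _ _ _ _ g _ g'} h (hg : IsRegularEpi g) =>
        show IsRegularEpi g' from isRegularEpi_of_surjective fun y => by
          obtain ⟨x, hx⟩ := surjective_of_isRegularEpi g _
          obtain ⟨z, -, hz⟩ := exists_of_isPullback h hx
          exact ⟨z, hz⟩ }

/-- The ideal of the elements related to zero by an internal reflexive relation. -/
def relIdeal {p₁ p₂ : K ⟶ L} (h : ReflexiveRelation p₁ p₂) : AlgIdeal k L where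
  carrier := {x | ∃ r, p₁.hom r = x ∧ p₂.hom r = 0}
  zero_mem' := ⟨0, map_zero _, map_zero _⟩
  add_mem' := by
    rintro _ _ ⟨r, rfl, hr⟩ ⟨r', rfl, hr'⟩
    exact ⟨r + r', map_add _ _ _, by rw [map_add, hr, hr', add_zero]⟩
  smul_mem' := by
    rintro c _ ⟨r, rfl, hr⟩
    exact ⟨c • r, map_smul _ _ _, by rw [map_smul, hr, smul_zero]⟩
  mul_left_mem := by
    rintro a _ ⟨r, rfl, hr⟩
    exact ⟨h.r.hom a * r, by rw [map_mul, ← comp_hom_apply h.r, h.reflexivity₁, id_hom_apply],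
      by rw [map_mul, hr, mul_zero]⟩
  mul_right_mem := by
    rintro a _ ⟨r, rfl, hr⟩
    exact ⟨r * h.r.hom a, by rw [map_mul, ← comp_hom_apply h.r, h.reflexivity₁, id_hom_apply],
      by rw [map_mul, hr, zero_mul]⟩

/-- Translating by diagonal elements turns a pair `(x, y)` of the relation into `(x - y, 0)` and
back. Thus reflexivity alone suffices; symmetry and transitivity follow. -/
theorem isKernelPair_quotMk_relIdeal {p₁ p₂ : K ⟶ L} (h : ReflexiveRelation p₁ p₂) :
    IsKernelPair (quotMk (relIdeal h)) p₁ p₂ := by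
  have h₁ : ∀ x, p₁.hom (h.r.hom x) = x := congr_hom h.reflexivity₁
  have h₂ : ∀ x, p₂.hom (h.r.hom x) = x := congr_hom h.reflexivity₂
  refine isPullback_of_elements (hom_ext fun x => ?_)
    (fun _ _ => eq_of_jointlyMono fun f g => h.right_cancellation f g) (fun x y e => ?_)
  · rw [comp_hom_apply, comp_hom_apply, ← sub_eq_zero, ← map_sub, quotMk_eq_zero]
    exact ⟨x - h.r.hom (p₂.hom x), by rw [map_sub, h₁], by rw [map_sub, h₂, sub_self]⟩
  · rw [← sub_eq_zero, ← map_sub, quotMk_eq_zero] at e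
    obtain ⟨r, hr₁, hr₂⟩ := e
    exact ⟨r + h.r.hom y, by rw [map_add, hr₁, h₁, sub_add_cancel],
      by rw [map_add, hr₂, h₂, zero_add]⟩

theorem isBarrExact : IsBarrExact (NovikovAlgCat.{u, v} k) where
  regular := regular
  effective _ _ _ _ h := by
    obtain ⟨h⟩ := h.nonempty_equivalenceRelation
    exact ⟨_, _, isKernelPair_quotMk_relIdeal h.toReflexiveRelation⟩

/-! ### Protomodularity -/

theorem isProtomodular : IsProtomodular (NovikovAlgCat.{u, v} k) := by
  intro A B E E' D D' b p s p' s' h c q t c' q' t' h' _ hs' hp hs hD _ _ hD' _ _ hc hq hiso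
  obtain ⟨h'inj, h'surj⟩ := bijective_of_isIso h'
  refine isIso_of_bijective ⟨?_, fun y => ?_⟩
  · rw [injective_iff_map_eq_zero]
    intro x hx
    -- An element of the kernel of `h` lies over `0`, and the fibre over `0` is unchanged by
    -- pullback along `b`, so injectivity of `h'` applies.
    obtain ⟨d, rfl, hd⟩ := exists_of_isPullback hD (x := x) (y := 0)
      (by rw [← hp, comp_hom_apply, hx, map_zero, map_zero])
    have : d = 0 := h'inj (eq_of_isPullback hD'
      (by rw [← comp_hom_apply, hc, comp_hom_apply, hx, map_zero, map_zero])
      (by rw [← comp_hom_apply, hq, hd, map_zero, map_zero]))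
    rw [this, map_zero]
  -- Subtracting the section part moves `y` into the fibre over `0`, where surjectivity of `h'`
  -- applies; the section part is the image under `h` of the section of `p`.
  · obtain ⟨d', hd', -⟩ := exists_of_isPullback hD' (x := y - s'.hom (p'.hom y)) (y := 0) (by
      rw [map_sub, ← comp_hom_apply s', hs', id_hom_apply, sub_self, map_zero])
    obtain ⟨d, rfl⟩ := h'surj d'
    refine ⟨c.hom d + s.hom (p'.hom y), ?_⟩
    rw [map_add, ← comp_hom_apply c, ← hc, comp_hom_apply, hd', ← comp_hom_apply s, hs,
      sub_add_cancel]

end NovikovAlgCat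

namespace NovikovAlgCat

variable {k : Type u} [Field k]

/-! ### Coproducts -/

section Coproduct

variable (L M : NovikovAlgCat.{u, max u v} k)

/-- The free nonassociative algebra on the disjoint union of `L` and `M`. -/
abbrev FreeOn : Type max u v := FreeNonUnitalNonAssocAlgebra k (L ⊕ M)

variable {L M} in
/-- The homomorphism from the free nonassociative algebra given by a pair of homomorphisms. -/
noncomputable def freeDesc {N : NovikovAlgCat.{u, max u v} k} (f : L ⟶ N) (g : M ⟶ N) :
    FreeOn L M →ₙₐ[k] N :=
  FreeNonUnitalNonAssocAlgebra.lift k (Sum.elim f.hom g.hom)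

/-- The ideal of the elements that vanish under all pairs of homomorphisms from `L` and `M` to a
Novikov algebra. -/
def coprodIdeal : AlgIdeal k (FreeOn L M) where
  carrier := {x | ∀ (N : NovikovAlgCat.{u, max u v} k) (f : L ⟶ N) (g : M ⟶ N),
    freeDesc f g x = 0}
  zero_mem' _ _ _ := map_zero _
  add_mem' ha hb N f g := by rw [map_add, ha N f g, hb N f g, add_zero]
  smul_mem' c x hx N f g := by rw [map_smul, hx N f g, smul_zero]
  mul_left_mem a x hx N f g := by rw [map_mul, hx N f g, mul_zero]
  mul_right_mem a x hx N f g := by rw [map_mul, hx N f g, zero_mul]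

/-- Reduces an equation in the coproduct to its instances in all Novikov algebras. It yields both
Novikov identities and makes the inclusions of generators homomorphisms. The free algebra involves
coefficients from `k` as well as generators, whence the universe `max u v`. -/
theorem coprod_toQuotient_eq {x y : FreeOn L M}
    (h : ∀ (N : NovikovAlgCat.{u, max u v} k) (f : L ⟶ N) (g : M ⟶ N),
      freeDesc f g x = freeDesc f g y) :
    (coprodIdeal L M).toQuotient x = (coprodIdeal L M).toQuotient y := by
  rw [AlgIdeal.toQuotient_eq]
  intro N f g
  rw [map_sub, h, sub_self]

/-- The coproduct of two Novikov algebras. -/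
noncomputable def coprod : NovikovAlgCat.{u, max u v} k :=
  of (coprodIdeal L M).Quotient
    (by
      intro x y z
      obtain ⟨x, rfl⟩ := AlgIdeal.toQuotient_surjective _ x
      obtain ⟨y, rfl⟩ := AlgIdeal.toQuotient_surjective _ y
      obtain ⟨z, rfl⟩ := AlgIdeal.toQuotient_surjective _ z
      refine coprod_toQuotient_eq L M (x := associator x y z) (y := associator y x z)
        fun N f g => ?_
      simp only [associator_apply, map_sub, map_mul]
      exact LeftPreLieRing.assoc_symm _ _ _)
    (by
      intro x y z
      obtain ⟨x, rfl⟩ := AlgIdeal.toQuotient_surjective _ x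
      obtain ⟨y, rfl⟩ := AlgIdeal.toQuotient_surjective _ y
      obtain ⟨z, rfl⟩ := AlgIdeal.toQuotient_surjective _ z
      refine coprod_toQuotient_eq L M (x := x * y * z) (y := x * z * y) fun N f g => ?_
      simp only [map_mul]
      exact NovikovRing.mul_mul_right_comm _ _ _)

/-- The first inclusion into the coproduct. -/
noncomputable def coprodInl : L ⟶ coprod L M where
  hom :=
    { toFun x := (coprodIdeal L M).toQuotient (FreeNonUnitalNonAssocAlgebra.of k (Sum.inl x))
      map_smul' c x := coprod_toQuotient_eq L M
        (y := c • FreeNonUnitalNonAssocAlgebra.of k (Sum.inl x)) fun N f g => by simp [freeDesc]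
      map_zero' := coprod_toQuotient_eq L M (y := 0) fun N f g => by simp [freeDesc]
      map_add' x y := coprod_toQuotient_eq L M
        (y := FreeNonUnitalNonAssocAlgebra.of k (Sum.inl x) +
          FreeNonUnitalNonAssocAlgebra.of k (Sum.inl y)) fun N f g => by simp [freeDesc]
      map_mul' x y := coprod_toQuotient_eq L M
        (y := FreeNonUnitalNonAssocAlgebra.of k (Sum.inl x) *
          FreeNonUnitalNonAssocAlgebra.of k (Sum.inl y)) fun N f g => by simp [freeDesc] }

/-- The second inclusion into the coproduct. -/
noncomputable def coprodInr : M ⟶ coprod L M where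
  hom :=
    { toFun x := (coprodIdeal L M).toQuotient (FreeNonUnitalNonAssocAlgebra.of k (Sum.inr x))
      map_smul' c x := coprod_toQuotient_eq L M
        (y := c • FreeNonUnitalNonAssocAlgebra.of k (Sum.inr x)) fun N f g => by simp [freeDesc]
      map_zero' := coprod_toQuotient_eq L M (y := 0) fun N f g => by simp [freeDesc]
      map_add' x y := coprod_toQuotient_eq L M
        (y := FreeNonUnitalNonAssocAlgebra.of k (Sum.inr x) +
          FreeNonUnitalNonAssocAlgebra.of k (Sum.inr y)) fun N f g => by simp [freeDesc]
      map_mul' x y := coprod_toQuotient_eq L M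
        (y := FreeNonUnitalNonAssocAlgebra.of k (Sum.inr x) *
          FreeNonUnitalNonAssocAlgebra.of k (Sum.inr y)) fun N f g => by simp [freeDesc] }

variable {L M}

theorem exists_coprod_desc {N : NovikovAlgCat.{u, max u v} k} (f : L ⟶ N) (g : M ⟶ N) :
    ∃ d : coprod L M ⟶ N, coprodInl L M ≫ d = f ∧ coprodInr L M ≫ d = g := by
  obtain ⟨d, hd⟩ := NonUnitalAlgHom.exists_comp_eq_of_surjective
    (coprodIdeal L M).mkHom_surjective (g := freeDesc f g)
    fun x hx => (coprodIdeal L M).mkHom_eq_zero.1 hx N f g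
  exact ⟨⟨d⟩, hom_ext fun x => (hd _).trans (FreeNonUnitalNonAssocAlgebra.lift_of_apply _ _ _),
    hom_ext fun x => (hd _).trans (FreeNonUnitalNonAssocAlgebra.lift_of_apply _ _ _)⟩

theorem coprod_hom_ext {N : NovikovAlgCat.{u, max u v} k} {f g : coprod L M ⟶ N}
    (h₁ : coprodInl L M ≫ f = coprodInl L M ≫ g) (h₂ : coprodInr L M ≫ f = coprodInr L M ≫ g) :
    f = g := by
  have h : f.hom.comp (coprodIdeal L M).mkHom = g.hom.comp (coprodIdeal L M).mkHom := by
    refine FreeNonUnitalNonAssocAlgebra.hom_ext k ?_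
    rintro (x | x)
    · exact congr_hom h₁ x
    · exact congr_hom h₂ x
  refine hom_ext fun x => ?_
  obtain ⟨x, rfl⟩ := (coprodIdeal L M).mkHom_surjective x
  exact NonUnitalAlgHom.congr_fun h x

instance : HasFiniteCoproducts (NovikovAlgCat.{u, max u v} k) := by
  have : HasInitial (NovikovAlgCat.{u, max u v} k) := HasZeroObject.hasInitial
  have (L M : NovikovAlgCat.{u, max u v} k) : HasColimit (pair L M) := by
    choose d hd using fun (N : NovikovAlgCat.{u, max u v} k) (f : L ⟶ N) (g : M ⟶ N) =>
      exists_coprod_desc f g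
    exact ⟨⟨⟨_, BinaryCofan.isColimitMk
      (inl := coprodInl L M) (inr := coprodInr L M) (fun s => d _ s.inl s.inr)
      (fun s => (hd _ _ _).1) (fun s => (hd _ _ _).2)
      (fun s m h₁ h₂ => coprod_hom_ext (h₁.trans (hd _ _ _).1.symm)
        (h₂.trans (hd _ _ _).2.symm))⟩⟩⟩
  have := hasBinaryCoproducts_of_hasColimit_pair (NovikovAlgCat.{u, max u v} k)
  exact hasFiniteCoproducts_of_has_binary_and_initial

end Coproduct

theorem isSemiAbelian : IsSemiAbelian (NovikovAlgCat.{u, max u v} k) where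
  hasZeroObject := inferInstance
  hasFiniteProducts := inferInstance
  hasFiniteCoproducts := inferInstance
  barrExact := isBarrExact
  protomodular := isProtomodular

/-! ### Action accessibility -/

section Accessible

variable {X : NovikovAlgCat.{u, v} k} (S : SplitExtension X)

theorem splitExtension_exists_add (e : S.E) : ∃ x b, e = S.ι.hom x + S.s.hom b := by
  obtain ⟨x, hx⟩ := exists_of_isLimit_kernelFork S.isKernel.some
    (x := e - S.s.hom (S.p.hom e)) (by
      rw [map_sub, ← comp_hom_apply S.s, S.s_p, id_hom_apply, sub_self])
  exact ⟨x, S.p.hom e, by rw [hx, sub_add_cancel]⟩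

theorem splitExtension_ι_injective : Function.Injective S.ι.hom :=
  injective_of_isLimit_kernelFork S.isKernel.some

theorem splitExtension_p_s (a : S.A) : S.p.hom (S.s.hom a) = a := congr_hom S.s_p a

theorem splitExtension_p_ι (x : X) : S.p.hom (S.ι.hom x) = 0 := congr_hom S.ι_p x

theorem splitExtension_exists_ι {e : S.E} (he : S.p.hom e = 0) : ∃ x, S.ι.hom x = e :=
  exists_of_isLimit_kernelFork S.isKernel.some he

/-- An element of the base of a split extension acts trivially on the kernel. -/
def ActsTrivially (a : S.A) : Prop :=
  ∀ x, S.s.hom a * S.ι.hom x = 0 ∧ S.ι.hom x * S.s.hom a = 0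

/-- A split extension is faithful when only zero acts trivially on the kernel. -/
theorem isFaithful_of_actsTrivially (h : ∀ a, ActsTrivially S a → a = 0) : S.IsFaithful := by
  intro T f g
  have hι : ∀ (f : T ⟶ S) (x : X), f.onE.hom (T.ι.hom x) = S.ι.hom x :=
    fun f => congr_hom f.ι_onE
  have hs : ∀ (f : T ⟶ S) (b : T.A), f.onE.hom (T.s.hom b) = S.s.hom (f.onA.hom b) :=
    fun f => congr_hom f.s_onE
  -- The products of `s b` with `ι x` lie in the kernel `X`, on which `f` and `g` agree. So the
  -- images of `b` under `f` and `g` act identically on `X`, and their difference acts trivially.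
  have hA : ∀ b, f.onA.hom b = g.onA.hom b := by
    intro b
    rw [← sub_eq_zero]
    refine h _ fun x => ⟨?_, ?_⟩
    · obtain ⟨y, hy⟩ := splitExtension_exists_ι T (e := T.s.hom b * T.ι.hom x) (by
        rw [map_mul, splitExtension_p_ι, mul_zero])
      rw [map_sub, sub_mul, sub_eq_zero, ← hs, ← hs]
      conv_lhs => rw [← hι f, ← map_mul, ← hy, hι]
      rw [← hι g x, ← map_mul, ← hy, hι]
    · obtain ⟨y, hy⟩ := splitExtension_exists_ι T (e := T.ι.hom x * T.s.hom b) (by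
        rw [map_mul, splitExtension_p_ι, zero_mul])
      rw [map_sub, mul_sub, sub_eq_zero, ← hs, ← hs]
      conv_lhs => rw [← hι f, ← map_mul, ← hy, hι]
      rw [← hι g x, ← map_mul, ← hy, hι]
  refine SplitExtension.Hom.ext (hom_ext fun e => ?_) (hom_ext hA)
  obtain ⟨x, b, rfl⟩ := splitExtension_exists_add T e
  rw [map_add, map_add, hι, hι, hs, hs, hA]

/-- The ideal of the base of a split extension formed by the elements that act trivially on the
kernel. -/
def centralizer : AlgIdeal k S.A where
  carrier := {a | ActsTrivially S a}
  zero_mem' x := by rw [map_zero, zero_mul, mul_zero]; exact ⟨rfl, rfl⟩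
  add_mem' {a b} ha hb x := by
    rw [map_add, add_mul, mul_add, (ha x).1, (ha x).2, (hb x).1, (hb x).2, add_zero]
    exact ⟨rfl, rfl⟩
  smul_mem' c a ha x := by
    rw [map_smul, smul_mul_assoc, mul_smul_comm, (ha x).1, (ha x).2, smul_zero]
    exact ⟨rfl, rfl⟩
  mul_left_mem b a ha x := by
    obtain ⟨y, hy⟩ := splitExtension_exists_ι S (e := S.ι.hom x * S.s.hom b) (by
      rw [map_mul, splitExtension_p_ι, zero_mul])
    obtain ⟨z, hz⟩ := splitExtension_exists_ι S (e := S.s.hom b * S.ι.hom x) (by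
      rw [map_mul, splitExtension_p_ι, mul_zero])
    rw [map_mul]
    refine ⟨?_, ?_⟩
    -- `(ba)x = (bx)a`, and `bx` is again in `X`.
    · rw [NovikovRing.mul_mul_right_comm, ← hz, (ha z).2]
    -- `x(ba) = (xb)a + b(xa) - (bx)a`, where `a` is multiplied with an element of `X` in every
    -- term.
    · rw [NovikovRing.mul_left_comm', (ha x).2, ← hy, ← hz, (ha y).2, (ha z).2, mul_zero,
        add_zero, sub_zero]
  mul_right_mem b a ha x := by
    obtain ⟨y, hy⟩ := splitExtension_exists_ι S (e := S.ι.hom x * S.s.hom b) (by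
      rw [map_mul, splitExtension_p_ι, zero_mul])
    rw [map_mul]
    refine ⟨?_, ?_⟩
    -- `(ab)x = (ax)b`.
    · rw [NovikovRing.mul_mul_right_comm, (ha x).1, zero_mul]
    -- `x(ab) = (xa)b + a(xb) - (ax)b`, with `xb` in `X`.
    · rw [NovikovRing.mul_left_comm', (ha x).1, (ha x).2, ← hy, (ha y).1, zero_mul,
        add_zero, sub_zero]

/-- The image of the centralizer under the section is an ideal of the total algebra. -/
def centralizerImage : AlgIdeal k S.E where
  carrier := {e | ∃ a, ActsTrivially S a ∧ S.s.hom a = e}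
  zero_mem' := ⟨0, (centralizer S).zero_mem', map_zero _⟩
  add_mem' := by
    rintro _ _ ⟨a, ha, rfl⟩ ⟨b, hb, rfl⟩
    exact ⟨a + b, (centralizer S).add_mem' ha hb, map_add _ _ _⟩
  smul_mem' := by
    rintro c _ ⟨a, ha, rfl⟩
    exact ⟨c • a, (centralizer S).smul_mem' c ha, map_smul _ _ _⟩
  mul_left_mem := by
    rintro e _ ⟨a, ha, rfl⟩
    obtain ⟨x, b, rfl⟩ := splitExtension_exists_add S e
    -- The `X`-component of the multiplier contributes nothing, since `a` annihilates `X`.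
    exact ⟨b * a, (centralizer S).mul_left_mem b ha, by
      rw [add_mul, (ha x).2, zero_add, map_mul]⟩
  mul_right_mem := by
    rintro e _ ⟨a, ha, rfl⟩
    obtain ⟨x, b, rfl⟩ := splitExtension_exists_add S e
    exact ⟨a * b, (centralizer S).mul_right_mem b ha, by
      rw [mul_add, (ha x).1, zero_add, map_mul]⟩

/-- The section and the kernel have images meeting only in zero, so `X` survives in the quotient of
`E`. -/
theorem quotMk_centralizerImage_ι_injective {x : X}
    (h : (quotMk (centralizerImage S)).hom (S.ι.hom x) = 0) : x = 0 := by
  rw [quotMk_eq_zero] at h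
  obtain ⟨a, -, ha⟩ := h
  have h0 : a = 0 := by
    rw [← splitExtension_p_s S a, ha, splitExtension_p_ι]
  apply splitExtension_ι_injective S
  rw [← ha, h0, map_zero, map_zero]

theorem isAccessible : S.IsAccessible := by
  let πE := quotMk (centralizerImage S)
  let πA := quotMk (centralizer S)
  have hE : ∀ {e}, πE.hom e = 0 ↔ ∃ a, ActsTrivially S a ∧ S.s.hom a = e := fun {e} =>
    quotMk_eq_zero (centralizerImage S)
  have hA : ∀ {a}, πA.hom a = 0 ↔ ActsTrivially S a := fun {e} =>
    quotMk_eq_zero (centralizer S)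
  have πEs : Function.Surjective πE.hom := quotMk_surjective _
  have πAs : Function.Surjective πA.hom := quotMk_surjective _
  obtain ⟨p, hp⟩ := exists_desc_of_surjective πEs (g := S.p ≫ πA) fun e he => by
    obtain ⟨a, ha, rfl⟩ := hE.1 he
    rw [comp_hom_apply, splitExtension_p_s]
    exact hA.2 ha
  obtain ⟨s, hs⟩ := exists_desc_of_surjective πAs (g := S.s ≫ πE) fun a ha =>
    hE.2 ⟨a, hA.1 ha, rfl⟩
  have hp' : ∀ e, p.hom (πE.hom e) = πA.hom (S.p.hom e) := congr_hom hp
  have hs' : ∀ a, s.hom (πA.hom a) = πE.hom (S.s.hom a) := congr_hom hs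
  have w : (S.ι ≫ πE) ≫ p = 0 := by
    rw [Category.assoc, hp, ← Category.assoc, S.ι_p, zero_comp]
  have hinj : Function.Injective (S.ι ≫ πE).hom :=
    (injective_iff_map_eq_zero _).2 fun _ => quotMk_centralizerImage_ι_injective S
  have hker : ∀ e, p.hom e = 0 → ∃ x, (S.ι ≫ πE).hom x = e := by
    intro e he
    obtain ⟨e, rfl⟩ := πEs e
    obtain ⟨x, b, rfl⟩ := splitExtension_exists_add S e
    rw [hp', map_add, splitExtension_p_ι, splitExtension_p_s, zero_add, hA] at he
    -- For `e = ι x + s b` over zero, `b` acts trivially, so `s b` dies in the quotient and only `x`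
    -- remains: the kernel does not grow.
    exact ⟨x, by rw [map_add, hE.2 ⟨b, he, rfl⟩, add_zero, comp_hom_apply]⟩
  let T : SplitExtension X :=
    { E := quot (centralizerImage S)
      A := quot (centralizer S)
      ι := S.ι ≫ πE
      p := p
      s := s
      ι_p := w
      isKernel := nonempty_isLimit_kernelFork w hinj hker
      s_p := hom_ext fun a => by
        obtain ⟨a, rfl⟩ := πAs a
        rw [comp_hom_apply, hs', hp', splitExtension_p_s, id_hom_apply] }
  refine ⟨T, isFaithful_of_actsTrivially T fun a ha => ?_, ⟨⟨πE, πA, rfl, hp, hs.symm⟩⟩⟩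
  obtain ⟨a, rfl⟩ := πAs a
  -- If the class of `a` acts trivially, the products of `s a` with `ι x` vanish in the quotient;
  -- being elements of `X`, they already vanish in `E`.
  refine hA.2 fun x => ⟨?_, ?_⟩
  · obtain ⟨y, hy⟩ := splitExtension_exists_ι S (e := S.s.hom a * S.ι.hom x) (by
      rw [map_mul, splitExtension_p_ι, mul_zero])
    have h : πE.hom (S.s.hom a * S.ι.hom x) = 0 := by
      rw [map_mul, ← hs']; exact (ha x).1
    rw [← hy] at h ⊢
    rw [quotMk_centralizerImage_ι_injective S h, map_zero]
  · obtain ⟨y, hy⟩ := splitExtension_exists_ι S (e := S.ι.hom x * S.s.hom a) (by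
      rw [map_mul, splitExtension_p_ι, zero_mul])
    have h : πE.hom (S.ι.hom x * S.s.hom a) = 0 := by
      rw [map_mul, ← hs']; exact (ha x).2
    rw [← hy] at h ⊢
    rw [quotMk_centralizerImage_ι_injective S h, map_zero]

end Accessible

end NovikovAlgCat

theorem mainTheorem4 (k : Type u) [Field k] :
    IsActionAccessible (NovikovAlgCat.{u, max u v} k) :=
  ⟨NovikovAlgCat.isSemiAbelian, fun _ S => NovikovAlgCat.isAccessible S⟩
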